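/- Let $m,n\ge 0$ be integers, let $K$ be a field, and let $\mathcal L=G(m,n)=C_{m+1}\times C_{n+1}$ be the $m\times n$ grid lattice, i.e. the product of the chains with $m+1$ and $n+1$ elements. Let $K[\mathcal L]=K[x_\alpha:\alpha\in\mathcal L]$, for every unordered pair $\{\alpha,\beta\}$ of incomparable elements of $\mathcal L$ (a diamond) let $f_{(\alpha,\beta)}=x_\alpha x_\beta-x_{\alpha\vee\beta}x_{\alpha\wedge\beta}$, let $I_{\mathcal L}$ be the ideal generated by all $f_{(\alpha,\beta)}$, and let $R[\mathcal L]=K[\mathcal L]/I_{\mathcal L}$ be the Hibi ring. The first syzygy module of $R[\mathcal L]$ is the kernel of the map $\bigoplus K[\mathcal L]\,g_{(\alpha,\beta)}\to K[\mathcal L]$, $g_{(\alpha,\beta)}\mapsto f_{(\alpha,\beta)}$, the sum being over all diamonds, and the first Betti number $\beta_1$ of $R[\mathcal L]$ is the minimal number of generators of this module. Then $$\beta_1=S(m,n)+L(m,n)+B(m,n),$$ and this number is also the rank of $F_2$ in every minimal graded free resolution $\cdots\to F_2\to F_1\to F_0\to R[\mathcal L]\to 0$ over $K[\mathcal L]$.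 Here $$S(m,n)=\binom{m+1}{2}T(n)+\binom{n+1}{2}T(m),\qquad T(n)=2\binom{n+1}{3},$$ $$L(m,n)=\frac{L(2,m)\,L(2,n)}{2},\qquad B(m,n)=\frac{B(2,m)\,B(2,n)}{2},\qquad B(2,n)=L(2,n)=\frac{n(n^2-1)}{3}.$$ -/

import Mathlib

open MvPolynomial

noncomputable section

/-- The diamonds of a lattice `L`: the unordered pairs of incomparable elements. -/
def Diamond (L : Type*) [Lattice L] : Type _ :=
  {s : Sym2 L // ∃ a b : L, s = s(a, b) ∧ ¬ a ≤ b ∧ ¬ b ≤ a}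

/-- The binomial `x_a x_b - x_{a ⊔ b} x_{a ⊓ b}` of an unordered pair `{a, b}`. -/
def pairBinomial (K : Type*) [Field K] (L : Type*) [Lattice L] : Sym2 L → MvPolynomial L K :=
  Sym2.lift ⟨fun a b => X a * X b - X (a ⊔ b) * X (a ⊓ b), fun a b => by
    simp only [mul_comm (X a) (X b), sup_comm a b, inf_comm a b]⟩

/-- The diamond relation `f_{(a, b)} = x_a x_b - x_{a ⊔ b} x_{a ⊓ b}` of a diamond. -/
def diamondRelation (K : Type*) [Field K] (L : Type*) [Lattice L] (s : Diamond L) :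
    MvPolynomial L K :=
  pairBinomial K L s.1

/-- The ideal `I_L` of `K[L]` generated by all diamond relations. The Hibi ring is
`R[L] = K[L] / I_L`. -/
def hibiIdeal (K : Type*) [Field K] (L : Type*) [Lattice L] : Ideal (MvPolynomial L K) :=
  Ideal.span (Set.range (diamondRelation K L))

/-- The map `⊕ K[L] g_{(a, b)} → K[L]`, `g_{(a, b)} ↦ f_{(a, b)}`, from the free module on the
diamonds. -/
def diamondMap (K : Type*) [Field K] (L : Type*) [Lattice L] :
    (Diamond L →₀ MvPolynomial L K) →ₗ[MvPolynomial L K] MvPolynomial L K :=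
  Finsupp.linearCombination (MvPolynomial L K) (diamondRelation K L)

/-- The first syzygy module of the Hibi ring `R[L]`: the relations among the diamond relations. -/
def firstSyzygy (K : Type*) [Field K] (L : Type*) [Lattice L] :
    Submodule (MvPolynomial L K) (Diamond L →₀ MvPolynomial L K) :=
  LinearMap.ker (diamondMap K L)

/-- The first Betti number of `R[L]`: the minimal number of generators of the first syzygy
module. -/
def firstBetti (K : Type*) [Field K] (L : Type*) [Lattice L] : ℕ :=
  (firstSyzygy K L).spanFinrank

/-- `p` lies in the degree `z` part of the polynomial ring (which is `0` for negative `z`). -/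
def IsHomogeneousOfIntDegree {K σ : Type*} [Field K] (p : MvPolynomial σ K) (z : ℤ) : Prop :=
  ∀ s ∈ p.support, ((Finsupp.degree s : ℕ) : ℤ) = z

/-- A minimal graded free resolution
`⋯ → F₂ → F₁ → F₀ → P / I → 0` over a polynomial ring `P`, where `F i = ⊕_j P(-deg i j)` is
free of finite rank `rank i`, its `j`-th basis vector having degree `deg i j`. -/
structure MinimalGradedFreeResolution (K σ : Type*) [Field K] (I : Ideal (MvPolynomial σ K)) where
  /-- the rank of `F i` -/
  rank : ℕ → ℕ
  /-- the degrees of the basis vectors of `F i` -/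
  deg : ∀ i, Fin (rank i) → ℤ
  /-- the map `F 0 → P / I` -/
  aug : (Fin (rank 0) → MvPolynomial σ K) →ₗ[MvPolynomial σ K] (MvPolynomial σ K ⧸ I)
  /-- the map `F (i + 1) → F i` -/
  d : ∀ i, (Fin (rank (i + 1)) → MvPolynomial σ K) →ₗ[MvPolynomial σ K]
    (Fin (rank i) → MvPolynomial σ K)
  aug_graded : ∀ j, ∃ p : MvPolynomial σ K,
    IsHomogeneousOfIntDegree p (deg 0 j) ∧ aug (Pi.single j 1) = Ideal.Quotient.mk I p
  d_graded : ∀ i j k,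
    IsHomogeneousOfIntDegree (d i (Pi.single j 1) k) (deg (i + 1) j - deg i k)
  aug_surjective : Function.Surjective aug
  exact_zero : Function.Exact (d 0) aug
  exact_succ : ∀ i, Function.Exact (d (i + 1)) (d i)
  /-- all entries of the matrices of the maps lie in the ideal generated by the variables -/
  minimal : ∀ i j k,
    d i (Pi.single j 1) k ∈ Ideal.span (Set.range (X : σ → MvPolynomial σ K))

/-- The `m × n` grid lattice: the product of the chains with `m + 1` and `n + 1` elements. -/
abbrev Grid (m n : ℕ) : Type := Fin (m + 1) × Fin (n + 1)

/-- `T(n) = 2 * C(n + 1, 3)`. -/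
def stripT (n : ℕ) : ℚ := 2 * ((n + 1).choose 3 : ℚ)

/-- `S(m, n) = C(m + 1, 2) T(n) + C(n + 1, 2) T(m)`. -/
def stripS (m n : ℕ) : ℚ :=
  ((m + 1).choose 2 : ℚ) * stripT n + ((n + 1).choose 2 : ℚ) * stripT m

/-- `L(2, n) = n (n ^ 2 - 1) / 3`. -/
def typeL2 (n : ℕ) : ℚ := (n : ℚ) * ((n : ℚ) ^ 2 - 1) / 3

/-- `L(m, n) = L(2, m) L(2, n) / 2`. -/
def typeL (m n : ℕ) : ℚ := typeL2 m * typeL2 n / 2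

/-- `B(2, n)`, which is equal to `L(2, n)`. -/
def boxB2 (n : ℕ) : ℚ := typeL2 n

/-- `B(m, n) = B(2, m) B(2, n) / 2`. -/
def boxB (m n : ℕ) : ℚ := boxB2 m * boxB2 n / 2

end

noncomputable section

/-! The syzygies of the diamond relations of a grid are generated by those with linear coefficients
(`linearSpan_eq_firstSyzygy`), so the Betti number is the dimension of a `K`-space and follows from
rank-nullity.

For the generation, monomials are straightened by replacing `x_a x_b` with `x_{a ⊔ b} x_{a ⊓ b}`,
each step being labelled by the corresponding multiple of `g_{(a, b)}` modulo linear syzygies. A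
weight on the grid makes this terminate. Two steps from one monomial either share a variable, and
then the comparison takes place in degree three, where the normal form is unique and two paths to it
differ by a linear syzygy; or they use disjoint pairs, and then the labels agree up to a Koszul
syzygy, which Laplace expansions of `3 × 3` minors reduce to linear ones. Newman's lemma turns this
local confluence into a potential on monomials. Its linear extension `Φ` sends `diamondMap z` to the
class of `z`, so the class of every syzygy vanishes.

For the count, a cubic form lies in the span of the products of a variable and a diamond relation
exactly when its coefficients sum to zero over each class of monomials with equal row and column
sums (`range_linear_eq`). For minimality, syzygies have no constant terms, so independent linear
syzygies stay independent modulo the variables. Comparing resolutions transfers the number to `F₂`.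
-/

theorem exists_lift_of_exact {R A B C P : Type*} [CommRing R] [AddCommGroup A] [AddCommGroup B]
    [AddCommGroup C] [AddCommGroup P] [Module R A] [Module R B] [Module R C] [Module R P]
    [Module.Projective R P] {f : A →ₗ[R] B} {g : B →ₗ[R] C} (h : Function.Exact f g)
    (u : P →ₗ[R] B) (hu : g ∘ₗ u = 0) : ∃ v : P →ₗ[R] A, f ∘ₗ v = u := by
  have hm : ∀ x, u x ∈ LinearMap.range f := fun x => (h (u x)).1 (LinearMap.congr_fun hu x)
  obtain ⟨v, hv⟩ := Module.projective_lifting_property f.rangeRestrict (u.codRestrict _ hm)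
    f.surjective_rangeRestrict
  refine ⟨v, LinearMap.ext fun x => ?_⟩
  exact congrArg Subtype.val (LinearMap.congr_fun hv x)

/-! ### Comparison of resolutions modulo an ideal. -/

section Comparison

variable {R M F₀ F₁ F₂ G₀ G₁ G₂ : Type*} [CommRing R] [AddCommGroup M] [Module R M]
  [AddCommGroup F₀] [AddCommGroup F₁] [AddCommGroup F₂] [Module R F₀] [Module R F₁] [Module R F₂]
  [AddCommGroup G₀] [AddCommGroup G₁] [AddCommGroup G₂] [Module R G₀] [Module R G₁] [Module R G₂]
  [Module.Projective R F₀] [Module.Projective R F₁] [Module.Projective R F₂]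

theorem exists_chain_map
    {ε : F₀ →ₗ[R] M} {d₀ : F₁ →ₗ[R] F₀} {d₁ : F₂ →ₗ[R] F₁}
    (hε₀ : ε ∘ₗ d₀ = 0) (hd : d₀ ∘ₗ d₁ = 0)
    {η : G₀ →ₗ[R] M} {e₀ : G₁ →ₗ[R] G₀} {e₁ : G₂ →ₗ[R] G₁}
    (hη : Function.Surjective η) (he₀ : Function.Exact e₀ η) (he₁ : Function.Exact e₁ e₀) :
    ∃ (a₀ : F₀ →ₗ[R] G₀) (a₁ : F₁ →ₗ[R] G₁) (a₂ : F₂ →ₗ[R] G₂),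
      η ∘ₗ a₀ = ε ∧ e₀ ∘ₗ a₁ = a₀ ∘ₗ d₀ ∧ e₁ ∘ₗ a₂ = a₁ ∘ₗ d₁ := by
  obtain ⟨a₀, h₀⟩ := Module.projective_lifting_property η ε hη
  obtain ⟨a₁, h₁⟩ := exists_lift_of_exact he₀ (a₀ ∘ₗ d₀)
    (by rw [← LinearMap.comp_assoc, h₀, hε₀])
  obtain ⟨a₂, h₂⟩ := exists_lift_of_exact he₁ (a₁ ∘ₗ d₁)
    (by rw [← LinearMap.comp_assoc, h₁, LinearMap.comp_assoc, hd, LinearMap.comp_zero])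
  exact ⟨a₀, a₁, a₂, h₀, h₁, h₂⟩

-- A lift of the identity is homotopic to it: up to `v ∘ d₁`, the difference `s₂ - id` takes values
-- in `ker d₁`. Minimality puts both contributions in `k • ⊤`.
omit [Module.Projective R F₂] in
theorem chain_map_sub_self_mem (k : Ideal R)
    {ε : F₀ →ₗ[R] M} {d₀ : F₁ →ₗ[R] F₀} {d₁ : F₂ →ₗ[R] F₁}
    (h₀ : Function.Exact d₀ ε) (h₁ : Function.Exact d₁ d₀)
    (hmin₁ : ∀ x, d₁ x ∈ k • (⊤ : Submodule R F₁))
    (hmin₂ : ∀ x, d₁ x = 0 → x ∈ k • (⊤ : Submodule R F₂))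
    {s₀ : F₀ →ₗ[R] F₀} {s₁ : F₁ →ₗ[R] F₁} {s₂ : F₂ →ₗ[R] F₂}
    (hs₀ : ε ∘ₗ s₀ = ε) (hs₁ : d₀ ∘ₗ s₁ = s₀ ∘ₗ d₀) (hs₂ : d₁ ∘ₗ s₂ = s₁ ∘ₗ d₁) (x : F₂) :
    s₂ x - x ∈ k • (⊤ : Submodule R F₂) := by
  -- `u` and `v` are the first two terms of the homotopy.
  obtain ⟨u, hu⟩ := exists_lift_of_exact h₀ (s₀ - LinearMap.id)
    (by rw [LinearMap.comp_sub, hs₀, LinearMap.comp_id, sub_self])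
  obtain ⟨v, hv⟩ := exists_lift_of_exact h₁ (s₁ - LinearMap.id - u ∘ₗ d₀) (by
    rw [LinearMap.comp_sub, ← LinearMap.comp_assoc, hu, LinearMap.comp_sub, hs₁,
      LinearMap.sub_comp, LinearMap.comp_id, LinearMap.id_comp, sub_self])
  have hz : d₁ (s₂ x - x - v (d₁ x)) = 0 := by
    have e₁ := LinearMap.congr_fun hv (d₁ x)
    have e₂ := LinearMap.congr_fun hs₂ x
    have e₃ : d₀ (d₁ x) = 0 := h₁.apply_apply_eq_zero x
    simp only [LinearMap.comp_apply, LinearMap.sub_apply, LinearMap.id_apply, e₃, map_zero,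
      sub_zero] at e₁ e₂
    rw [map_sub, map_sub, e₁, e₂, sub_self]
  have hk : v (d₁ x) ∈ k • (⊤ : Submodule R F₂) := by
    have := Submodule.mem_map_of_mem (f := v) (hmin₁ x)
    rw [Submodule.map_smul''] at this
    exact Submodule.smul_mono le_rfl le_top this
  simpa using add_mem (hmin₂ _ hz) hk

end Comparison

theorem apply_mem_of_mem_smul_top {R : Type*} [CommRing R] {k : Ideal R} {ι : Type*}
    {x : ι → R} (hx : x ∈ k • (⊤ : Submodule R (ι → R))) (i : ι) : x i ∈ k := by
  refine Submodule.smul_induction_on hx (fun r hr n _ => ?_) (fun a b ha hb => ?_)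
  · exact k.mul_mem_right _ hr
  · exact k.add_mem ha hb

theorem mem_smul_top_of_forall_apply_mem {R : Type*} [CommRing R] {k : Ideal R} {ι : Type*}
    [Finite ι] {x : ι → R} (hx : ∀ i, x i ∈ k) : x ∈ k • (⊤ : Submodule R (ι → R)) := by
  classical
  have := Fintype.ofFinite ι
  rw [pi_eq_sum_univ' x]
  exact sum_mem fun i _ => Submodule.smul_mem_smul (hx i) trivial

/-- If two maps between finite free modules compose to the identity modulo the kernel of a map
to a field, then the rank of the source is at most the rank of the target. -/
theorem le_of_comp_sub_self_mem {R K : Type*} [CommRing R] [Field K] (f : R →+* K) {p q : ℕ}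
    (a : (Fin p → R) →ₗ[R] (Fin q → R)) (b : (Fin q → R) →ₗ[R] (Fin p → R))
    (h : ∀ x, b (a x) - x ∈ RingHom.ker f • (⊤ : Submodule R (Fin p → R))) : p ≤ q := by
  have key : (LinearMap.toMatrix' b).map f * (LinearMap.toMatrix' a).map f = 1 := by
    rw [← Matrix.map_mul, ← LinearMap.toMatrix'_comp]
    ext i j
    have := apply_mem_of_mem_smul_top (h (Pi.single j 1)) i
    rw [RingHom.mem_ker, Pi.sub_apply, map_sub, sub_eq_zero] at this
    rw [Matrix.map_apply, LinearMap.toMatrix'_apply, LinearMap.comp_apply, this, Pi.single_apply,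
      Matrix.one_apply]
    split_ifs <;> simp
  have h₁ := Matrix.rank_mul_le_left ((LinearMap.toMatrix' b).map f) ((LinearMap.toMatrix' a).map f)
  rw [key, Matrix.rank_one, Fintype.card_fin] at h₁
  exact h₁.trans (by simpa using Matrix.rank_le_card_width ((LinearMap.toMatrix' b).map f))

/-! ### Linear syzygies and the lower bound for the number of generators. -/

section Linear

variable (K : Type*) [Field K] {L : Type*} [Lattice L]

/-- The diamond of two incomparable elements. -/
def diamondOf {a b : L} (h : ¬ a ≤ b ∧ ¬ b ≤ a) : Diamond L := ⟨s(a, b), a, b, rfl, h⟩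

theorem exists_eq_diamondOf (s : Diamond L) :
    ∃ (a b : L) (h : ¬ a ≤ b ∧ ¬ b ≤ a), s = diamondOf h := by
  obtain ⟨e, a, b, rfl, h⟩ := s
  exact ⟨a, b, h, rfl⟩

theorem diamondOf_comm {a b : L} (h : ¬ a ≤ b ∧ ¬ b ≤ a) : diamondOf h = diamondOf h.symm :=
  Subtype.ext Sym2.eq_swap

theorem diamondRelation_diamondOf {a b : L} (h : ¬ a ≤ b ∧ ¬ b ≤ a) :
    diamondRelation K L (diamondOf h) = X a * X b - X (a ⊔ b) * X (a ⊓ b) := rfl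

open Classical in
/-- The generator `g_{(a, b)}` if `a` and `b` are incomparable, and `0` otherwise. -/
def pairGen (a b : L) : Diamond L →₀ MvPolynomial L K :=
  if h : ¬ a ≤ b ∧ ¬ b ≤ a then Finsupp.single (diamondOf h) 1 else 0

theorem pairGen_of_incomparable {a b : L} (h : ¬ a ≤ b ∧ ¬ b ≤ a) :
    pairGen K a b = Finsupp.single (diamondOf h) 1 := dif_pos h

theorem pairGen_of_le {a b : L} (h : a ≤ b) : pairGen K a b = 0 := dif_neg fun h' => h'.1 h

theorem pairGen_comm (a b : L) : pairGen K a b = pairGen K b a := by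
  unfold pairGen
  by_cases h : ¬ a ≤ b ∧ ¬ b ≤ a
  · rw [dif_pos h, dif_pos h.symm]
    rw [diamondOf_comm]
  · rw [dif_neg h, dif_neg fun h' => h h'.symm]

@[simp]
theorem diamondMap_single (s : Diamond L) (r : MvPolynomial L K) :
    diamondMap K L (Finsupp.single s r) = r * diamondRelation K L s := by
  simp [diamondMap]

theorem diamondMap_pairGen (a b : L) :
    diamondMap K L (pairGen K a b) = X a * X b - X (a ⊔ b) * X (a ⊓ b) := by
  by_cases h : ¬ a ≤ b ∧ ¬ b ≤ a
  · rw [pairGen_of_incomparable K h, diamondMap_single, one_mul, diamondRelation_diamondOf]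
  · rw [pairGen, dif_neg h, map_zero]
    rcases not_and_or.1 h with h | h
    · rw [sup_eq_right.2 (not_not.1 h), inf_eq_left.2 (not_not.1 h), mul_comm, sub_self]
    · rw [sup_eq_left.2 (not_not.1 h), inf_eq_right.2 (not_not.1 h), sub_self]

variable (L) in
/-- The inclusion of the elements with linear coefficients in the free module on the diamonds. -/
def linearEmb : (Diamond L × L →₀ K) →ₗ[K] (Diamond L →₀ MvPolynomial L K) :=
  Finsupp.linearCombination K fun q => Finsupp.single q.1 (X q.2)

variable (L) in
/-- The coefficients of the degree one monomials in an element of the free module. -/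
def linearCoeff : (Diamond L →₀ MvPolynomial L K) →ₗ[K] (Diamond L × L → K) :=
  LinearMap.pi fun q => lcoeff K (Finsupp.single q.2 1) ∘ₗ
    (Finsupp.lapply q.1 : (Diamond L →₀ MvPolynomial L K) →ₗ[K] MvPolynomial L K)

variable (L) in
/-- The syzygies of the diamond relations with linear coefficients. -/
def linearSyzygy : Submodule K (Diamond L × L →₀ K) :=
  LinearMap.ker ((diamondMap K L).restrictScalars K ∘ₗ linearEmb K L)

variable (L) in
/-- The submodule generated by the linear syzygies. -/
def linearSpan : Submodule (MvPolynomial L K) (Diamond L →₀ MvPolynomial L K) :=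
  Submodule.span (MvPolynomial L K) (linearEmb K L '' linearSyzygy K L)

theorem linearCoeff_apply (z : Diamond L →₀ MvPolynomial L K) (q : Diamond L × L) :
    linearCoeff K L z q = coeff (Finsupp.single q.2 1) (z q.1) := rfl

theorem linearEmb_single (q : Diamond L × L) (c : K) :
    linearEmb K L (Finsupp.single q c) = c • Finsupp.single q.1 (X q.2) := by
  simp [linearEmb]

theorem linearCoeff_linearEmb (c : Diamond L × L →₀ K) : linearCoeff K L (linearEmb K L c) = c := by
  classical
  induction c using Finsupp.induction_linear with
  | zero => simp
  | add f g hf hg => rw [map_add, map_add, hf, hg, Finsupp.coe_add]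
  | single q c =>
    ext ⟨s, p⟩
    obtain ⟨t, r⟩ := q
    rw [linearEmb_single, map_smul, Pi.smul_apply, linearCoeff_apply, Finsupp.single_apply,
      Finsupp.single_apply]
    by_cases h : t = s
    · simp [h, coeff_X, Finsupp.single_left_inj]
    · simp [h]

theorem linearEmb_mem_linearSpan {c : Diamond L × L →₀ K}
    (h : diamondMap K L (linearEmb K L c) = 0) : linearEmb K L c ∈ linearSpan K L :=
  Submodule.subset_span ⟨c, h, rfl⟩

theorem linearSpan_le_firstSyzygy : linearSpan K L ≤ firstSyzygy K L := by
  rw [linearSpan, Submodule.span_le]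
  rintro _ ⟨c, hc, rfl⟩
  exact hc

/-- Setting all variables except `x_a` and `x_b` to zero kills every relation but that of `{a, b}`,
which becomes `x_a x_b`. The coefficient of `g_{(a, b)}` in a syzygy therefore specializes to zero,
and the specialization preserves constant terms. -/
theorem constantCoeff_eq_zero_of_mem_firstSyzygy {z : Diamond L →₀ MvPolynomial L K}
    (hz : z ∈ firstSyzygy K L) (s : Diamond L) : constantCoeff (z s) = 0 := by
  classical
  obtain ⟨a, b, hab, rfl⟩ := exists_eq_diamondOf s
  let ψ : MvPolynomial L K →ₐ[K] MvPolynomial L K :=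
    aeval fun p => if p = a ∨ p = b then X p else 0
  have hψ : ∀ p, constantCoeff (ψ p) = constantCoeff p := by
    intro p
    induction p using MvPolynomial.induction_on with
    | C c => simp [ψ]
    | add p q hp hq => simp [hp, hq]
    | mul_X p q hp =>
      rw [map_mul, map_mul, map_mul, constantCoeff_X, mul_zero, aeval_X]
      split_ifs <;> simp
  have hrel : ∀ t, t ≠ diamondOf hab → ψ (diamondRelation K L t) = 0 := by
    intro t ht
    obtain ⟨c, d, hcd, rfl⟩ := exists_eq_diamondOf t
    have hcd' : c ≠ d := fun h => hcd.1 h.le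
    have h₁ : ¬ ((c = a ∨ c = b) ∧ (d = a ∨ d = b)) := by
      rintro ⟨rfl | rfl, rfl | rfl⟩
      · exact hcd' rfl
      · exact ht rfl
      · exact ht (diamondOf_comm _)
      · exact hcd' rfl
    -- Join and meet are distinct and comparable, so they cannot both lie in the incomparable pair
    -- `{a, b}`.
    have h₂ : ¬ ((c ⊔ d = a ∨ c ⊔ d = b) ∧ (c ⊓ d = a ∨ c ⊓ d = b)) := by
      have hle : c ⊓ d ≤ c ⊔ d := inf_le_sup
      have hne : c ⊓ d ≠ c ⊔ d := fun h => hcd' (inf_eq_sup.1 h)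
      rintro ⟨h | h, h' | h'⟩
      · exact hne (h'.trans h.symm)
      · exact hab.2 (h ▸ h' ▸ hle)
      · exact hab.1 (h ▸ h' ▸ hle)
      · exact hne (h'.trans h.symm)
    have hX : ∀ p q : L, ¬ ((p = a ∨ p = b) ∧ (q = a ∨ q = b)) → ψ (X p) * ψ (X q) = 0 := by
      intro p q h
      rw [aeval_X, aeval_X]
      rcases not_and_or.1 h with h | h
      · rw [if_neg h, zero_mul]
      · rw [if_neg h, mul_zero]
    rw [diamondRelation_diamondOf, map_sub, map_mul, map_mul, hX _ _ h₁, hX _ _ h₂, sub_zero]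
  have h₀ : diamondMap K L z = 0 := hz
  rw [diamondMap, Finsupp.linearCombination_apply, Finsupp.sum] at h₀
  have h₁ := congrArg ψ h₀
  rw [map_sum, map_zero, Finset.sum_eq_single (diamondOf hab)] at h₁
  · have h₂ : ψ (diamondRelation K L (diamondOf hab)) ≠ 0 := by
      have h₃ : ¬ (a ⊔ b = a ∨ a ⊔ b = b) := by
        rw [sup_eq_left, sup_eq_right]; tauto
      rw [diamondRelation_diamondOf, map_sub, map_mul, map_mul]
      simp only [ψ, aeval_X, true_or, or_true, if_true, if_neg h₃, zero_mul, sub_zero]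
      exact mul_ne_zero (X_ne_zero a) (X_ne_zero b)
    rw [smul_eq_mul, map_mul, mul_eq_zero, or_iff_left h₂] at h₁
    rw [← hψ, h₁, map_zero]
  · intro t _ ht
    rw [smul_eq_mul, map_mul, hrel t ht, mul_zero]
  · intro h
    rw [Finsupp.notMem_support_iff.1 h]
    simp

/-- As the entries of `z` have no constant term, only the constant term of `r` affects the linear
part. Hence the linear parts of any generators span all linear parts of syzygies over `K`. -/
theorem linearCoeff_smul {z : Diamond L →₀ MvPolynomial L K} (hz : z ∈ firstSyzygy K L)
    (r : MvPolynomial L K) : linearCoeff K L (r • z) = constantCoeff r • linearCoeff K L z := by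
  classical
  ext ⟨s, p⟩
  have h := constantCoeff_eq_zero_of_mem_firstSyzygy K hz s
  rw [constantCoeff_eq] at h
  simp only [linearCoeff_apply, Pi.smul_apply, Finsupp.smul_apply, smul_eq_mul, coeff_mul,
    Finsupp.antidiagonal_single]
  simp [Finset.Nat.antidiagonal_succ, h, constantCoeff_eq]

/-- A generating family of the syzygies has at least as many elements as there are independent
linear syzygies. -/
theorem finrank_linearSyzygy_le [Finite L] (t : Finset (Diamond L →₀ MvPolynomial L K))
    (ht : Submodule.span (MvPolynomial L K) (t : Set (Diamond L →₀ MvPolynomial L K)) =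
      firstSyzygy K L) :
    Module.finrank K (linearSyzygy K L) ≤ t.card := by
  classical
  let V := Submodule.span K (t.image (linearCoeff K L) : Set (Diamond L × L → K))
  have hV : ∀ z ∈ firstSyzygy K L, linearCoeff K L z ∈ V := by
    intro z hz
    rw [← ht] at hz
    induction hz using Submodule.span_induction with
    | mem x hx => exact Submodule.subset_span (by simpa using ⟨x, hx, rfl⟩)
    | zero => rw [map_zero]; exact V.zero_mem
    | add x y _ _ hx hy => rw [map_add]; exact V.add_mem hx hy
    | smul r x hx' hx =>
      rw [ht] at hx'
      rw [linearCoeff_smul K hx']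
      exact V.smul_mem _ hx
  let f : linearSyzygy K L →ₗ[K] V :=
    (linearCoeff K L ∘ₗ linearEmb K L ∘ₗ (linearSyzygy K L).subtype).codRestrict V
      fun c => hV _ c.2
  have hf : Function.Injective f := by
    intro c d h
    have h := congrArg Subtype.val h
    simp only [f, LinearMap.codRestrict_apply, LinearMap.comp_apply, linearCoeff_linearEmb] at h
    exact Subtype.ext (DFunLike.coe_injective h)
  calc Module.finrank K (linearSyzygy K L) ≤ Module.finrank K V :=
        LinearMap.finrank_le_finrank_of_injective hf
    _ ≤ (t.image (linearCoeff K L)).card := finrank_span_finset_le_card _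
    _ ≤ t.card := Finset.card_image_le

instance [Finite L] : Finite (Diamond L) := inferInstanceAs (Finite (Subtype _))

omit [Lattice L] in
theorem exists_linearIndependent_span_eq {V : Type*} [AddCommGroup V] [Module K V]
    (W : Submodule K V) [Module.Finite K W] :
    ∃ v : Fin (Module.finrank K W) → V,
      LinearIndependent K v ∧ Submodule.span K (Set.range v) = W := by
  let b := Module.finBasis K W
  refine ⟨fun i => b i, b.linearIndependent.map' _ (Submodule.ker_subtype _), ?_⟩
  have h := congrArg (Submodule.map W.subtype) b.span_eq
  rwa [Submodule.map_span, Submodule.map_subtype_top, ← Set.range_comp] at h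

variable (L) in
theorem exists_linear_generators [Finite L] :
    ∃ v : Fin (Module.finrank K (linearSyzygy K L)) → (Diamond L × L →₀ K),
      LinearIndependent K v ∧
      Submodule.span (MvPolynomial L K) (Set.range fun i => linearEmb K L (v i)) =
        linearSpan K L := by
  obtain ⟨v, hv, hs⟩ := exists_linearIndependent_span_eq K (linearSyzygy K L)
  refine ⟨v, hv, ?_⟩
  generalize Module.finrank K (linearSyzygy K L) = N at v
  rw [linearSpan, ← Submodule.map_coe, ← hs, Submodule.map_span, Submodule.span_span_of_tower,
    ← Set.range_comp]
  rfl

theorem firstBetti_eq [Finite L] (h : linearSpan K L = firstSyzygy K L) :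
    firstBetti K L = Module.finrank K (linearSyzygy K L) := by
  have hfg : (firstSyzygy K L).FG := IsNoetherian.noetherian _
  apply le_antisymm
  · obtain ⟨v, -, hv⟩ := exists_linear_generators K L
    rw [firstBetti, ← h, ← hv]
    refine (Submodule.spanFinrank_span_le_ncard_of_finite (Set.finite_range _)).trans ?_
    rw [← Set.image_univ]
    refine (Set.ncard_image_le Set.finite_univ).trans ?_
    simp [Set.ncard_univ]
  · obtain ⟨t, ht, hs⟩ := hfg.exists_span_finset_card_eq_spanFinrank
    rw [firstBetti, ← ht]
    exact finrank_linearSyzygy_le K t hs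

end Linear

/-! ### Koszul syzygies from Laplace expansions of minors. -/

section Koszul

variable (K : Type*) [Field K] {α β : Type*} [LinearOrder α] [LinearOrder β]

/-- The combination of generators that is mapped to a `2 × 2` minor. -/
def minorGen (i i' : α) (j j' : β) : Diamond (α × β) →₀ MvPolynomial (α × β) K :=
  pairGen K (i, j) (i', j') - pairGen K (i, j') (i', j)

/-- Both diagonals of the `2 × 2` block have the same join and meet, so those products cancel. No
order of the indices is needed, which spares the determinantal identities any case distinction. -/
theorem diamondMap_minorGen (i i' : α) (j j' : β) :
    diamondMap K (α × β) (minorGen K i i' j j') =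
      X (i, j) * X (i', j') - X (i, j') * X (i', j) := by
  rw [minorGen, map_sub, diamondMap_pairGen, diamondMap_pairGen]
  simp only [Prod.mk_sup_mk, Prod.mk_inf_mk, sup_comm j' j, inf_comm j' j]
  ring

theorem X_smul_pairGen_mem_range {L : Type*} [Lattice L] (p a b : L) :
    (X p : MvPolynomial L K) • pairGen K a b ∈ LinearMap.range (linearEmb K L) := by
  by_cases h : ¬ a ≤ b ∧ ¬ b ≤ a
  · exact ⟨Finsupp.single (diamondOf h, p) 1, by
      rw [linearEmb_single, pairGen_of_incomparable K h, Finsupp.smul_single]; simp⟩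
  · rw [pairGen, dif_neg h, smul_zero]
    exact zero_mem _

theorem X_smul_minorGen_mem_range (p : α × β) (i i' : α) (j j' : β) :
    (X p : MvPolynomial (α × β) K) • minorGen K i i' j j' ∈
      LinearMap.range (linearEmb K (α × β)) := by
  rw [minorGen, smul_sub]
  exact sub_mem (X_smul_pairGen_mem_range K _ _ _) (X_smul_pairGen_mem_range K _ _ _)

/-- The class of `minorGen` modulo the linear syzygies. -/
def minorClass (i i' : α) (j j' : β) :
    (Diamond (α × β) →₀ MvPolynomial (α × β) K) ⧸ linearSpan K (α × β) :=
  (linearSpan K (α × β)).mkQ (minorGen K i i' j j')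

/-- The difference of the expansions of a `3 × 3` minor along its first row and last column. -/
theorem laplace_relation (i₀ i₁ i₂ : α) (j₀ j₁ j₂ : β) :
    (X (i₀, j₀) : MvPolynomial (α × β) K) • minorClass K i₁ i₂ j₁ j₂
      - (X (i₀, j₁) : MvPolynomial (α × β) K) • minorClass K i₁ i₂ j₀ j₂
      + (X (i₁, j₂) : MvPolynomial (α × β) K) • minorClass K i₀ i₂ j₀ j₁
      - (X (i₂, j₂) : MvPolynomial (α × β) K) • minorClass K i₀ i₁ j₀ j₁ = 0 := by
  simp only [minorClass, ← map_smul, ← map_sub, ← map_add]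
  rw [Submodule.mkQ_apply, Submodule.Quotient.mk_eq_zero]
  obtain ⟨c, hc⟩ := sub_mem (add_mem (sub_mem (X_smul_minorGen_mem_range K (i₀, j₀) i₁ i₂ j₁ j₂)
    (X_smul_minorGen_mem_range K (i₀, j₁) i₁ i₂ j₀ j₂))
    (X_smul_minorGen_mem_range K (i₁, j₂) i₀ i₂ j₀ j₁))
    (X_smul_minorGen_mem_range K (i₂, j₂) i₀ i₁ j₀ j₁)
  rw [← hc]
  refine linearEmb_mem_linearSpan K ?_
  rw [hc]
  simp only [map_sub, map_add, map_smul, diamondMap_minorGen, smul_eq_mul]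
  ring

/-- The Koszul syzygies are generated by the linear syzygies. -/
theorem koszul_relation (i₀ i₁ i₂ i₃ : α) (j₀ j₁ j₂ j₃ : β) :
    (X (i₂, j₂) * X (i₃, j₃) - X (i₂, j₃) * X (i₃, j₂) : MvPolynomial (α × β) K) •
        minorClass K i₀ i₁ j₀ j₁ =
      (X (i₀, j₀) * X (i₁, j₁) - X (i₀, j₁) * X (i₁, j₀) : MvPolynomial (α × β) K) •
        minorClass K i₂ i₃ j₂ j₃ := by
  have h₁ := laplace_relation K i₁ i₂ i₃ j₁ j₂ j₃
  have h₂ := laplace_relation K i₀ i₁ i₂ j₀ j₁ j₂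
  have h₃ := laplace_relation K i₀ i₂ i₃ j₀ j₁ j₃
  have h₄ := laplace_relation K i₀ i₁ i₃ j₀ j₁ j₂
  have h₅ := laplace_relation K i₁ i₂ i₃ j₀ j₂ j₃
  -- `h₂` and `h₄` produce the left side, `h₁` and `h₅` the right side; the surviving terms all
  -- contain `x_{(i₁, j₂)}` and are cancelled by `h₃`.
  linear_combination (norm := module) -(X (i₀, j₀) : MvPolynomial (α × β) K) • h₁
    - (X (i₃, j₃) : MvPolynomial (α × β) K) • h₂ - (X (i₁, j₂) : MvPolynomial (α × β) K) • h₃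
    + (X (i₂, j₃) : MvPolynomial (α × β) K) • h₄ + (X (i₀, j₁) : MvPolynomial (α × β) K) • h₅

/-- When one diagonal of a block is incomparable, the other is comparable and its generator is zero.
-/
theorem pairGen_eq_minorGen {a b : α × β} (h : ¬ a ≤ b ∧ ¬ b ≤ a) :
    pairGen K a b = minorGen K a.1 b.1 a.2 b.2 := by
  have h' : pairGen K (a.1, b.2) (b.1, a.2) = 0 := by
    simp only [Prod.le_def] at h
    rcases le_total a.1 b.1 with h₁ | h₁ <;> rcases le_total a.2 b.2 with h₂ | h₂
    · exact absurd ⟨h₁, h₂⟩ h.1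
    · exact pairGen_of_le K (Prod.mk_le_mk.2 ⟨h₁, h₂⟩)
    · rw [pairGen_comm]
      exact pairGen_of_le K (Prod.mk_le_mk.2 ⟨h₁, h₂⟩)
    · exact absurd ⟨h₁, h₂⟩ h.2
  rw [minorGen, h', sub_zero]

theorem koszul_pairGen {a b c d : α × β} (hab : ¬ a ≤ b ∧ ¬ b ≤ a) (hcd : ¬ c ≤ d ∧ ¬ d ≤ c) :
    (X c * X d - X (c ⊔ d) * X (c ⊓ d) : MvPolynomial (α × β) K) •
        (linearSpan K (α × β)).mkQ (pairGen K a b) =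
      (X a * X b - X (a ⊔ b) * X (a ⊓ b) : MvPolynomial (α × β) K) •
        (linearSpan K (α × β)).mkQ (pairGen K c d) := by
  have h := koszul_relation K a.1 b.1 c.1 d.1 a.2 b.2 c.2 d.2
  rw [← diamondMap_pairGen, ← diamondMap_pairGen, pairGen_eq_minorGen K hab,
    pairGen_eq_minorGen K hcd, diamondMap_minorGen, diamondMap_minorGen]
  exact h

end Koszul

/-! ### Newman's lemma with labels. -/

section Newman

/-- Paths of a labelled relation, labelled by the sum of the labels of their steps. -/
inductive LabeledPath {S A : Type*} [AddCommMonoid A] (step : S → A → S → Prop) :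
    S → A → S → Prop
  | refl (M : S) : LabeledPath step M 0 M
  | cons {M : S} {q : A} {M' : S} {r : A} {N : S} :
      step M q M' → LabeledPath step M' r N → LabeledPath step M (q + r) N

namespace LabeledPath

theorem single {S A : Type*} [AddCommMonoid A] {step : S → A → S → Prop} {M N : S} {q : A}
    (h : step M q N) : LabeledPath step M q N := by
  simpa using cons h (refl N)

theorem trans {S A : Type*} [AddCommMonoid A] {step : S → A → S → Prop} {M N P : S} {q r : A}
    (h : LabeledPath step M q N) (h' : LabeledPath step N r P) :
    LabeledPath step M (q + r) P := by
  induction h with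
  | refl M => simpa using h'
  | cons h _ ih => rw [add_assoc]; exact cons h (ih h')

theorem map {S A S' A' : Type*} [AddCommMonoid A] [AddCommMonoid A'] {step : S → A → S → Prop}
    {step' : S' → A' → S' → Prop} (f : S → S') (g : A →+ A')
    (hfg : ∀ M q N, step M q N → step' (f M) (g q) (f N)) {M N : S} {q : A}
    (h : LabeledPath step M q N) : LabeledPath step' (f M) (g q) (f N) := by
  induction h with
  | refl M => rw [map_zero]; exact refl _
  | cons h _ ih => rw [map_add]; exact cons (hfg _ _ _ h) ih

theorem exists_normal {S A : Type*} [AddCommMonoid A] {step : S → A → S → Prop} (μ : S → ℕ)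
    (hμ : ∀ M q N, step M q N → μ N < μ M) (M : S) :
    ∃ q N, LabeledPath step M q N ∧ ∀ r P, ¬ step N r P := by
  induction hk : μ M using Nat.strong_induction_on generalizing M with
  | _ k ih =>
    by_cases h : ∀ r P, ¬ step M r P
    · exact ⟨0, M, refl M, h⟩
    · push Not at h
      obtain ⟨r, P, h⟩ := h
      obtain ⟨q, N, hP, hN⟩ := ih _ (hk ▸ hμ _ _ _ h) P rfl
      exact ⟨r + q, N, cons h hP, hN⟩

/-- Newman's lemma for labelled relations: local confluence and termination imply that the labels
are the differences of a potential. -/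
theorem exists_potential {S A : Type*} [AddCommGroup A] {step : S → A → S → Prop} (μ : S → ℕ)
    (hμ : ∀ M q N, step M q N → μ N < μ M)
    (hconf : ∀ M q N q' N', step M q N → step M q' N' → ∃ P r r',
      LabeledPath step N r P ∧ LabeledPath step N' r' P ∧ q + r = q' + r') :
    ∃ φ : S → A, ∀ M q N, step M q N → φ M = q + φ N := by
  -- Any two paths from `M` to normal forms have the same end and the same label. The potential is
  -- then the label of any path to a normal form.
  have key : ∀ k M, μ M = k → ∀ q N q' N', LabeledPath step M q N → (∀ r P, ¬ step N r P) →
      LabeledPath step M q' N' → (∀ r P, ¬ step N' r P) → N = N' ∧ q = q' := by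
    intro k
    induction k using Nat.strong_induction_on with
    | _ k ih =>
      rintro M rfl q N q' N' h hN h' hN'
      cases h with
      | refl M =>
        cases h' with
        | refl M => exact ⟨rfl, rfl⟩
        | cons hs _ => exact absurd hs (hN _ _)
      | cons hs hp =>
        cases h' with
        | refl M => exact absurd hs (hN' _ _)
        | cons hs' hp' =>
          -- Close the fork at `P` and continue to a normal form `P'`; induction at the two targets
          -- of the first steps compares each given path with the one through `P`.
          obtain ⟨P, r, r', hr, hr', e⟩ := hconf _ _ _ _ _ hs hs'
          obtain ⟨t, P', ht, hP'⟩ := exists_normal μ hμ P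
          obtain ⟨rfl, rfl⟩ := ih _ (hμ _ _ _ hs) _ rfl _ _ _ _ hp hN (hr.trans ht) hP'
          obtain ⟨rfl, rfl⟩ := ih _ (hμ _ _ _ hs') _ rfl _ _ _ _ hp' hN' (hr'.trans ht) hP'
          exact ⟨rfl, by rw [← add_assoc, e, add_assoc]⟩
  choose φ N hφ hN using exists_normal μ hμ
  refine ⟨φ, fun M q M' h => ?_⟩
  exact (key _ M rfl _ _ _ _ (hφ M) (hN M) (cons h (hφ M')) (hN M')).2

end LabeledPath

end Newman

/-! ### Exponent vectors and their degrees. -/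

section Exponents

theorem exists_add_single_of_mem_support {σ : Type*} {P : σ →₀ ℕ} {p : σ} (hp : p ∈ P.support) :
    ∃ Q, P = Q + Finsupp.single p 1 := by
  refine ⟨P - Finsupp.single p 1, (tsub_add_cancel_of_le ?_).symm⟩
  rw [Finsupp.single_le_iff]
  exact Nat.one_le_iff_ne_zero.2 (Finsupp.mem_support_iff.1 hp)

theorem exists_add_single_of_degree_eq_succ {σ : Type*} {P : σ →₀ ℕ} {k : ℕ}
    (h : P.degree = k + 1) : ∃ Q p, P = Q + Finsupp.single p 1 ∧ Q.degree = k := by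
  have h₀ : P ≠ 0 := by rintro rfl; simp at h
  obtain ⟨p, hp⟩ := Finsupp.support_nonempty_iff.2 h₀
  obtain ⟨Q, rfl⟩ := exists_add_single_of_mem_support hp
  exact ⟨Q, p, rfl, by simpa using h⟩

theorem degree_mapDomain_nat {γ δ : Type*} (f : γ → δ) (M : γ →₀ ℕ) :
    (M.mapDomain f).degree = M.degree := by
  induction M using Finsupp.induction_linear with
  | zero => simp
  | add P Q hP hQ => rw [Finsupp.mapDomain_add, map_add, map_add, hP, hQ]
  | single p k => rw [Finsupp.mapDomain_single, Finsupp.degree_single, Finsupp.degree_single]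

theorem mem_support_mapDomain_nat {γ δ : Type*} (f : γ → δ) (M : γ →₀ ℕ) {d : δ} :
    d ∈ (M.mapDomain f).support ↔ ∃ c ∈ M.support, f c = d := by
  classical
  rw [Finsupp.mapDomain_support_of_subsingletonAddUnits, Finset.mem_image]

end Exponents

/-! ### Straightening steps on monomials. -/

section Step

variable (K : Type*) [Field K] {L : Type*} [Lattice L]

/-- A monomial with two incomparable variables is straightened by one diamond relation. -/
def HibiStep (M : L →₀ ℕ) (z : Diamond L →₀ MvPolynomial L K) (N : L →₀ ℕ) : Prop :=
  ∃ (w : L →₀ ℕ) (a b : L), (¬ a ≤ b ∧ ¬ b ≤ a) ∧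
    M = w + (Finsupp.single a 1 + Finsupp.single b 1) ∧
    z = (monomial w 1 : MvPolynomial L K) • pairGen K a b ∧
    N = w + (Finsupp.single (a ⊔ b) 1 + Finsupp.single (a ⊓ b) 1)

variable {K}

theorem HibiStep.of_diamond {a b : L} (h : ¬ a ≤ b ∧ ¬ b ≤ a) (w : L →₀ ℕ) :
    HibiStep K (w + (Finsupp.single a 1 + Finsupp.single b 1))
      ((monomial w 1 : MvPolynomial L K) • pairGen K a b)
      (w + (Finsupp.single (a ⊔ b) 1 + Finsupp.single (a ⊓ b) 1)) :=
  ⟨w, a, b, h, rfl, rfl, rfl⟩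

theorem HibiStep.add_left {M N : L →₀ ℕ} {z : Diamond L →₀ MvPolynomial L K}
    (h : HibiStep K M z N) (v : L →₀ ℕ) :
    HibiStep K (v + M) ((monomial v 1 : MvPolynomial L K) • z) (v + N) := by
  obtain ⟨w, a, b, h, rfl, rfl, rfl⟩ := h
  exact ⟨v + w, a, b, h, by rw [add_assoc], by rw [smul_smul, monomial_mul, one_mul],
    by rw [add_assoc]⟩

theorem HibiStep.degree_eq {M N : L →₀ ℕ} {z : Diamond L →₀ MvPolynomial L K}
    (h : HibiStep K M z N) : N.degree = M.degree := by
  obtain ⟨w, a, b, h, rfl, rfl, rfl⟩ := h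
  simp

theorem HibiStep.diamondMap_eq {M N : L →₀ ℕ} {z : Diamond L →₀ MvPolynomial L K}
    (h : HibiStep K M z N) : diamondMap K L z = monomial M 1 - monomial N 1 := by
  obtain ⟨w, a, b, h, rfl, rfl, rfl⟩ := h
  rw [map_smul, diamondMap_pairGen, smul_eq_mul, mul_sub]
  simp [X, monomial_mul]

/-- In degree three the cofactor `w` of the straightened pair is a single variable, so the label has
linear coefficients. -/
theorem HibiStep.mem_range {M N : L →₀ ℕ} {z : Diamond L →₀ MvPolynomial L K}
    (h : HibiStep K M z N) (hM : M.degree = 3) : z ∈ LinearMap.range (linearEmb K L) := by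
  obtain ⟨w, a, b, h, rfl, rfl, rfl⟩ := h
  have hw : w.degree = 1 := by simpa using hM
  obtain ⟨p, rfl⟩ : ∃ p, w = Finsupp.single p 1 := by
    obtain ⟨Q, p, rfl, hQ⟩ := exists_add_single_of_degree_eq_succ hw
    exact ⟨p, by rw [(Finsupp.degree_eq_zero_iff _).1 hQ, zero_add]⟩
  exact X_smul_pairGen_mem_range K p a b

theorem LabeledPath.diamondMap_eq {M N : L →₀ ℕ} {z : Diamond L →₀ MvPolynomial L K}
    (h : LabeledPath (HibiStep K) M z N) : diamondMap K L z = monomial M 1 - monomial N 1 := by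
  induction h with
  | refl M => simp
  | cons h _ ih => rw [map_add, h.diamondMap_eq, ih, sub_add_sub_cancel]

theorem LabeledPath.mem_range {M N : L →₀ ℕ} {z : Diamond L →₀ MvPolynomial L K}
    (h : LabeledPath (HibiStep K) M z N) (hM : M.degree = 3) :
    z ∈ LinearMap.range (linearEmb K L) := by
  induction h with
  | refl M => exact zero_mem _
  | cons h _ ih => exact add_mem (h.mem_range hM) (ih (h.degree_eq.trans hM))

theorem comparable_of_normal {N : L →₀ ℕ}
    (h : ∀ (z : Diamond L →₀ MvPolynomial L K) P, ¬ HibiStep K N z P) {a b : L}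
    (ha : a ∈ N.support) (hb : b ∈ N.support) : a ≤ b ∨ b ≤ a := by
  classical
  by_contra! hab
  have hne : a ≠ b := fun e => hab.1 e.le
  have hle : Finsupp.single a 1 + Finsupp.single b 1 ≤ N := by
    intro p
    rw [Finsupp.add_apply, Finsupp.single_apply, Finsupp.single_apply]
    have ha := Finsupp.mem_support_iff.1 ha
    have hb := Finsupp.mem_support_iff.1 hb
    split_ifs with h₁ h₂ h₂
    · exact absurd (h₁.trans h₂.symm) hne
    · subst h₁; omega
    · subst h₂; omega
    · omega
  exact h _ _ ⟨N - (Finsupp.single a 1 + Finsupp.single b 1), a, b, hab,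
    (tsub_add_cancel_of_le hle).symm, rfl, rfl⟩

end Step

/-! ### Row and column sums, and uniqueness of the chain monomial. -/

section Marginals

variable {α β : Type*}

/-- The row and column sums of a matrix of exponents. -/
def marginals (M : α × β →₀ ℕ) : (α →₀ ℕ) × (β →₀ ℕ) :=
  (M.mapDomain Prod.fst, M.mapDomain Prod.snd)

theorem marginals_add (M N : α × β →₀ ℕ) : marginals (M + N) = marginals M + marginals N := by
  simp [marginals, Finsupp.mapDomain_add]

variable [LinearOrder α] [LinearOrder β]

theorem single_sup_add_single_inf {γ : Type*} [LinearOrder γ] (a b : γ) :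
    Finsupp.single (a ⊔ b) 1 + Finsupp.single (a ⊓ b) 1 =
      (Finsupp.single a 1 + Finsupp.single b 1 : γ →₀ ℕ) := by
  rcases le_total a b with h | h
  · rw [sup_eq_right.2 h, inf_eq_left.2 h, add_comm]
  · rw [sup_eq_left.2 h, inf_eq_right.2 h]

variable {K : Type*} [Field K]

theorem HibiStep.marginals_eq {M N : α × β →₀ ℕ}
    {z : Diamond (α × β) →₀ MvPolynomial (α × β) K} (h : HibiStep K M z N) :
    marginals N = marginals M := by
  obtain ⟨w, a, b, h, rfl, rfl, rfl⟩ := h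
  rw [marginals_add, marginals_add]
  simp [marginals, Finsupp.mapDomain_add, Finsupp.mapDomain_single, single_sup_add_single_inf]

theorem LabeledPath.marginals_eq {M N : α × β →₀ ℕ}
    {z : Diamond (α × β) →₀ MvPolynomial (α × β) K} (h : LabeledPath (HibiStep K) M z N) :
    marginals N = marginals M := by
  induction h with
  | refl M => rfl
  | cons h _ ih => exact ih.trans h.marginals_eq

theorem exists_least_of_chain {N : α × β →₀ ℕ} (h₀ : N ≠ 0)
    (h : ∀ a ∈ N.support, ∀ b ∈ N.support, a ≤ b ∨ b ≤ a) :
    ∃ p ∈ N.support, ∀ q ∈ N.support, p ≤ q := by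
  obtain ⟨p, hp⟩ := N.support.exists_minimal (Finsupp.support_nonempty_iff.2 h₀)
  exact ⟨p, hp.1, fun q hq => (h p hp.1 q hq).elim id fun hqp => hp.2 hq hqp⟩

/-- The row and the column of `p'` both occur in `N`, possibly at different elements, and `p` lies
below both of these. -/
theorem least_le_of_marginals_eq {N N' : α × β →₀ ℕ} {p p' : α × β}
    (hp : ∀ q ∈ N.support, p ≤ q) (hp' : p' ∈ N'.support) (e : marginals N = marginals N') :
    p ≤ p' := by
  have e₁ : N.mapDomain Prod.fst = N'.mapDomain Prod.fst := congrArg Prod.fst e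
  have e₂ : N.mapDomain Prod.snd = N'.mapDomain Prod.snd := congrArg Prod.snd e
  obtain ⟨q, hq, h₁⟩ := (mem_support_mapDomain_nat Prod.fst N).1
    (e₁ ▸ (mem_support_mapDomain_nat Prod.fst N').2 ⟨p', hp', rfl⟩)
  obtain ⟨r, hr, h₂⟩ := (mem_support_mapDomain_nat Prod.snd N).1
    (e₂ ▸ (mem_support_mapDomain_nat Prod.snd N').2 ⟨p', hp', rfl⟩)
  exact ⟨h₁ ▸ (hp q hq).1, h₂ ▸ (hp r hr).2⟩

/-- A chain monomial is determined by its row and column sums. -/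
theorem eq_of_chain_of_marginals_eq {N N' : α × β →₀ ℕ}
    (h : ∀ a ∈ N.support, ∀ b ∈ N.support, a ≤ b ∨ b ≤ a)
    (h' : ∀ a ∈ N'.support, ∀ b ∈ N'.support, a ≤ b ∨ b ≤ a)
    (e : marginals N = marginals N') : N = N' := by
  have hdeg : N.degree = N'.degree := by
    have := congrArg (fun x : (α →₀ ℕ) × (β →₀ ℕ) => x.1.degree) e
    simpa [marginals, degree_mapDomain_nat] using this
  induction hk : N.degree generalizing N N' with
  | zero =>
    rw [hk] at hdeg
    rw [(Finsupp.degree_eq_zero_iff _).1 hk, (Finsupp.degree_eq_zero_iff _).1 hdeg.symm]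
  | succ k ih =>
    have h₀ : N ≠ 0 := by rintro rfl; simp at hk
    have h₀' : N' ≠ 0 := by rintro rfl; simp at hdeg; omega
    obtain ⟨p, hp, hpl⟩ := exists_least_of_chain h₀ h
    obtain ⟨p', hp', hpl'⟩ := exists_least_of_chain h₀' h'
    -- The least elements agree; removing one copy of them lowers the degree.
    obtain rfl : p = p' := le_antisymm (least_le_of_marginals_eq hpl hp' e)
      (least_le_of_marginals_eq hpl' hp e.symm)
    obtain ⟨Q, rfl⟩ := exists_add_single_of_mem_support hp
    obtain ⟨Q', rfl⟩ := exists_add_single_of_mem_support hp'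
    have hs : ∀ {Q : α × β →₀ ℕ}, Q.support ⊆ (Q + Finsupp.single p 1).support := by
      intro Q q hq
      rw [Finsupp.mem_support_iff] at hq ⊢
      rw [Finsupp.add_apply]
      omega
    rw [ih (fun a ha b hb => h a (hs ha) b (hs hb)) (fun a ha b hb => h' a (hs ha) b (hs hb))]
    · rw [marginals_add, marginals_add] at e
      exact add_right_cancel e
    · simpa using hdeg
    · simpa using hk

end Marginals

/-! ### Confluence on the grid and generation by linear syzygies. -/

section Grid

/-- A strictly submodular weight on the monomials of the grid. -/
def gridWeight {a b : ℕ} (M : Fin a × Fin b →₀ ℕ) : ℕ :=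
  Finsupp.weight (fun p : Fin a × Fin b => (p.1 : ℕ) * (p.2.rev : ℕ)) M

/-- For `i < i'` and `j > j'` the weight drops by `(i' - i) * (j - j')`; reversing the column index
turns this into a decrease within `ℕ`. -/
theorem HibiStep.gridWeight_lt {K : Type*} [Field K] {a b : ℕ} {M N : Fin a × Fin b →₀ ℕ}
    {z : Diamond (Fin a × Fin b) →₀ MvPolynomial (Fin a × Fin b) K} (h : HibiStep K M z N) :
    gridWeight N < gridWeight M := by
  obtain ⟨w, ⟨i, j⟩, ⟨i', j'⟩, ⟨h₁, h₂⟩, rfl, rfl, rfl⟩ := h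
  simp only [gridWeight, map_add, Finsupp.weight_single, one_smul, Prod.mk_sup_mk, Prod.mk_inf_mk]
  refine Nat.add_lt_add_left ?_ _
  rw [Prod.mk_le_mk] at h₁ h₂
  rcases le_total i i' with hi | hi <;> rcases le_total j j' with hj | hj
  · exact absurd ⟨hi, hj⟩ h₁
  · have hi' : i < i' := lt_of_not_ge fun h => h₂ ⟨h, hj⟩
    have hj' : j'.rev > j.rev := Fin.rev_lt_rev.2 (lt_of_not_ge fun h => h₁ ⟨hi, h⟩)
    rw [sup_eq_right.2 hi, inf_eq_left.2 hi, sup_eq_left.2 hj, inf_eq_right.2 hj]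
    rw [Fin.lt_def] at hi'
    rw [gt_iff_lt, Fin.lt_def] at hj'
    nlinarith
  · have hi' : i' < i := lt_of_not_ge fun h => h₁ ⟨h, hj⟩
    have hj' : j.rev > j'.rev := Fin.rev_lt_rev.2 (lt_of_not_ge fun h => h₂ ⟨hi, h⟩)
    rw [sup_eq_left.2 hi, inf_eq_right.2 hi, sup_eq_right.2 hj, inf_eq_left.2 hj]
    rw [Fin.lt_def] at hi'
    rw [gt_iff_lt, Fin.lt_def] at hj'
    nlinarith
  · exact absurd ⟨hi, hj⟩ h₂

variable (K : Type*) [Field K] {a b : ℕ}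

variable (a b) in
/-- The free module on the diamonds of a grid modulo the linear syzygies. -/
abbrev LinearQuotient : Type _ :=
  (Diamond (Fin a × Fin b) →₀ MvPolynomial (Fin a × Fin b) K) ⧸ linearSpan K (Fin a × Fin b)

/-- The straightening steps, labelled modulo the linear syzygies. -/
def HibiStepMod (M : Fin a × Fin b →₀ ℕ) (q : LinearQuotient K a b)
    (N : Fin a × Fin b →₀ ℕ) : Prop :=
  ∃ z, HibiStep K M z N ∧ (linearSpan K (Fin a × Fin b)).mkQ z = q

variable {K}

theorem LabeledPath.add_left {M N : Fin a × Fin b →₀ ℕ}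
    {z : Diamond (Fin a × Fin b) →₀ MvPolynomial (Fin a × Fin b) K}
    (h : LabeledPath (HibiStep K) M z N) (v : Fin a × Fin b →₀ ℕ) :
    LabeledPath (HibiStepMod K) (v + M)
      ((monomial v 1 : MvPolynomial (Fin a × Fin b) K) • (linearSpan K (Fin a × Fin b)).mkQ z)
      (v + N) :=
  h.map (v + ·) (((monomial v 1 : MvPolynomial (Fin a × Fin b) K) •
      (linearSpan K (Fin a × Fin b)).mkQ).toAddMonoidHom)
    fun _ _ _ hs => ⟨_, hs.add_left v, by rw [map_smul]; rfl⟩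

/-- Both ends are chain monomials with the marginals of `t`, hence equal. The difference of the
labels then maps to zero and has linear coefficients, so it is itself a linear syzygy. -/
theorem mkQ_eq_of_path_of_degree_eq_three {t N N' : Fin a × Fin b →₀ ℕ}
    {z z' : Diamond (Fin a × Fin b) →₀ MvPolynomial (Fin a × Fin b) K} (ht : t.degree = 3)
    (h : LabeledPath (HibiStep K) t z N)
    (hN : ∀ (y : Diamond (Fin a × Fin b) →₀ MvPolynomial (Fin a × Fin b) K) P, ¬ HibiStep K N y P)
    (h' : LabeledPath (HibiStep K) t z' N')
    (hN' : ∀ (y : Diamond (Fin a × Fin b) →₀ MvPolynomial (Fin a × Fin b) K) P,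
      ¬ HibiStep K N' y P) :
    N = N' ∧ (linearSpan K (Fin a × Fin b)).mkQ z = (linearSpan K (Fin a × Fin b)).mkQ z' := by
  obtain rfl : N = N' := eq_of_chain_of_marginals_eq
    (fun _ hx _ hy => comparable_of_normal hN hx hy)
    (fun _ hx _ hy => comparable_of_normal hN' hx hy) (h.marginals_eq.trans h'.marginals_eq.symm)
  refine ⟨rfl, ?_⟩
  rw [← sub_eq_zero, ← map_sub, Submodule.mkQ_apply, Submodule.Quotient.mk_eq_zero]
  obtain ⟨c, hc⟩ := sub_mem (h.mem_range ht) (h'.mem_range ht)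
  rw [← hc]
  refine linearEmb_mem_linearSpan K ?_
  rw [hc, map_sub, h.diamondMap_eq, h'.diamondMap_eq, sub_self]

theorem confluent_of_degree_eq_three {t t₁ t₂ : Fin a × Fin b →₀ ℕ}
    {z₁ z₂ : Diamond (Fin a × Fin b) →₀ MvPolynomial (Fin a × Fin b) K} (ht : t.degree = 3)
    (h₁ : HibiStep K t z₁ t₁) (h₂ : HibiStep K t z₂ t₂) (v : Fin a × Fin b →₀ ℕ) :
    ∃ P r r', LabeledPath (HibiStepMod K) (v + t₁) r P ∧ LabeledPath (HibiStepMod K) (v + t₂) r' P ∧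
      (linearSpan K (Fin a × Fin b)).mkQ ((monomial v 1 : MvPolynomial (Fin a × Fin b) K) • z₁) + r =
      (linearSpan K (Fin a × Fin b)).mkQ
        ((monomial v 1 : MvPolynomial (Fin a × Fin b) K) • z₂) + r' := by
  have hμ : ∀ (M : Fin a × Fin b →₀ ℕ) (q) (N), HibiStep K M q N → gridWeight N < gridWeight M :=
    fun _ _ _ h => h.gridWeight_lt
  obtain ⟨q₁, N₁, hp₁, hN₁⟩ := LabeledPath.exists_normal gridWeight hμ t₁
  obtain ⟨q₂, N₂, hp₂, hN₂⟩ := LabeledPath.exists_normal gridWeight hμ t₂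
  obtain ⟨rfl, e⟩ := mkQ_eq_of_path_of_degree_eq_three ht (.cons h₁ hp₁) hN₁ (.cons h₂ hp₂) hN₂
  refine ⟨_, _, _, hp₁.add_left v, hp₂.add_left v, ?_⟩
  rw [map_smul, map_smul, ← smul_add, ← smul_add, ← map_add, ← map_add, e]

/-- If `d ≠ e`, the monomial is `v · x_c x_d x_e`, so the cubic case multiplied by `v` applies. -/
theorem confluent_of_overlap {c d e : Fin a × Fin b} (hd : ¬ c ≤ d ∧ ¬ d ≤ c)
    (he : ¬ c ≤ e ∧ ¬ e ≤ c) {w w' : Fin a × Fin b →₀ ℕ}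
    (h : w + Finsupp.single d 1 = w' + Finsupp.single e 1) :
    ∃ P r r',
      LabeledPath (HibiStepMod K)
        (w + (Finsupp.single (c ⊔ d) 1 + Finsupp.single (c ⊓ d) 1)) r P ∧
      LabeledPath (HibiStepMod K)
        (w' + (Finsupp.single (c ⊔ e) 1 + Finsupp.single (c ⊓ e) 1)) r' P ∧
      (linearSpan K (Fin a × Fin b)).mkQ
        ((monomial w 1 : MvPolynomial (Fin a × Fin b) K) • pairGen K c d) + r =
      (linearSpan K (Fin a × Fin b)).mkQ
        ((monomial w' 1 : MvPolynomial (Fin a × Fin b) K) • pairGen K c e) + r' := by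
  by_cases hde : d = e
  · subst hde
    obtain rfl := add_right_cancel h
    exact ⟨_, _, _, .refl _, .refl _, rfl⟩
  · obtain ⟨v, rfl⟩ : ∃ v, w = v + Finsupp.single e 1 := by
      refine exists_add_single_of_mem_support (Finsupp.mem_support_iff.2 fun h₀ => ?_)
      have := DFunLike.congr_fun h e
      simp [h₀, hde] at this
    obtain rfl : w' = v + Finsupp.single d 1 := by
      apply add_right_cancel (b := Finsupp.single e 1)
      rw [← h]
      abel
    have h₁ := HibiStep.of_diamond (K := K) hd (Finsupp.single e 1)
    have h₂ := HibiStep.of_diamond (K := K) he (Finsupp.single d 1)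
    rw [show Finsupp.single d 1 + (Finsupp.single c 1 + Finsupp.single e 1) =
      (Finsupp.single e 1 + (Finsupp.single c 1 + Finsupp.single d 1) : Fin a × Fin b →₀ ℕ)
      by abel] at h₂
    have := confluent_of_degree_eq_three (by simp) h₁ h₂ v
    simpa only [smul_smul, monomial_mul, one_mul, add_assoc] using this

/-- Each step is followed by the other one. The two labels differ by a multiple of the Koszul syzygy
of the two relations. -/
theorem confluent_of_disjoint {c d e f : Fin a × Fin b} (hcd : ¬ c ≤ d ∧ ¬ d ≤ c)
    (hef : ¬ e ≤ f ∧ ¬ f ≤ e) (v : Fin a × Fin b →₀ ℕ) :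
    ∃ P r r',
      LabeledPath (HibiStepMod K)
        (v + (Finsupp.single e 1 + Finsupp.single f 1) +
          (Finsupp.single (c ⊔ d) 1 + Finsupp.single (c ⊓ d) 1)) r P ∧
      LabeledPath (HibiStepMod K)
        (v + (Finsupp.single c 1 + Finsupp.single d 1) +
          (Finsupp.single (e ⊔ f) 1 + Finsupp.single (e ⊓ f) 1)) r' P ∧
      (linearSpan K (Fin a × Fin b)).mkQ
        ((monomial (v + (Finsupp.single e 1 + Finsupp.single f 1)) 1 :
          MvPolynomial (Fin a × Fin b) K) • pairGen K c d) + r =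
      (linearSpan K (Fin a × Fin b)).mkQ
        ((monomial (v + (Finsupp.single c 1 + Finsupp.single d 1)) 1 :
          MvPolynomial (Fin a × Fin b) K) • pairGen K e f) + r' := by
  have h₁ := HibiStep.of_diamond (K := K) hef
    (v + (Finsupp.single (c ⊔ d) 1 + Finsupp.single (c ⊓ d) 1))
  have h₂ := HibiStep.of_diamond (K := K) hcd
    (v + (Finsupp.single (e ⊔ f) 1 + Finsupp.single (e ⊓ f) 1))
  have hm : ∀ p q : Fin a × Fin b,
      (monomial (v + (Finsupp.single p 1 + Finsupp.single q 1)) 1 :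
        MvPolynomial (Fin a × Fin b) K) = monomial v 1 * (X p * X q) := by
    intro p q
    simp [X, monomial_mul]
  rw [add_right_comm v] at h₁ h₂
  refine ⟨_, _, (linearSpan K (Fin a × Fin b)).mkQ
    ((monomial (v + (Finsupp.single (e ⊔ f) 1 + Finsupp.single (e ⊓ f) 1)) 1 :
      MvPolynomial (Fin a × Fin b) K) • pairGen K c d), .single ⟨_, h₁, rfl⟩, ?_, ?_⟩
  · rw [add_right_comm v (Finsupp.single (c ⊔ d) 1 + Finsupp.single (c ⊓ d) 1)]
    exact .single ⟨_, h₂, rfl⟩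
  · have h := congrArg ((monomial v 1 : MvPolynomial (Fin a × Fin b) K) • ·)
      (koszul_pairGen K hcd hef)
    simp only [map_smul, hm] at h ⊢
    linear_combination (norm := module) h

theorem hibiStepMod_confluent (M : Fin a × Fin b →₀ ℕ) (q : LinearQuotient K a b)
    (N : Fin a × Fin b →₀ ℕ) (q' : LinearQuotient K a b) (N' : Fin a × Fin b →₀ ℕ)
    (h : HibiStepMod K M q N) (h' : HibiStepMod K M q' N') :
    ∃ P r r', LabeledPath (HibiStepMod K) N r P ∧ LabeledPath (HibiStepMod K) N' r' P ∧
      q + r = q' + r' := by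
  obtain ⟨_, ⟨w, c, d, hcd, rfl, rfl, rfl⟩, rfl⟩ := h
  obtain ⟨_, ⟨w', e, f, hef, hM, rfl, rfl⟩, rfl⟩ := h'
  by_cases h₁ : c = e
  · subst h₁
    refine confluent_of_overlap hcd hef (add_right_cancel (b := Finsupp.single c 1) ?_)
    rw [add_assoc, add_assoc, add_comm _ (Finsupp.single c 1), add_comm _ (Finsupp.single c 1), hM]
  by_cases h₂ : c = f
  · subst h₂
    rw [pairGen_comm K e, sup_comm e, inf_comm e]
    refine confluent_of_overlap hcd hef.symm (add_right_cancel (b := Finsupp.single c 1) ?_)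
    rw [add_assoc, add_assoc, add_comm (Finsupp.single d 1), hM]
  by_cases h₃ : d = e
  · subst h₃
    rw [pairGen_comm K c, sup_comm c, inf_comm c]
    refine confluent_of_overlap hcd.symm hef (add_right_cancel (b := Finsupp.single d 1) ?_)
    rw [add_assoc, add_assoc, add_comm (Finsupp.single f 1), hM]
  by_cases h₄ : d = f
  · subst h₄
    rw [pairGen_comm K c, sup_comm c, inf_comm c, pairGen_comm K e, sup_comm e, inf_comm e]
    refine confluent_of_overlap hcd.symm hef.symm (add_right_cancel (b := Finsupp.single d 1) ?_)
    rw [add_assoc, add_assoc, hM]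
  -- No variable is shared from here on, so `x_c x_d` divides the cofactor `w'`.
  have hne : c ≠ d := fun h => hcd.1 h.le
  obtain ⟨u, rfl⟩ : ∃ u, w' = u + Finsupp.single c 1 := by
    refine exists_add_single_of_mem_support (Finsupp.mem_support_iff.2 fun h₀ => ?_)
    have := DFunLike.congr_fun hM c
    simp [h₀, Ne.symm h₁, Ne.symm h₂, hne] at this
  obtain ⟨v, rfl⟩ : ∃ v, u = v + Finsupp.single d 1 := by
    refine exists_add_single_of_mem_support (Finsupp.mem_support_iff.2 fun h₀ => ?_)
    have := DFunLike.congr_fun hM d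
    simp [h₀, Ne.symm h₃, Ne.symm h₄, hne.symm] at this
  obtain rfl : w = v + (Finsupp.single e 1 + Finsupp.single f 1) := by
    apply add_right_cancel (b := Finsupp.single c 1 + Finsupp.single d 1)
    rw [hM]
    abel
  rw [add_assoc v (Finsupp.single d 1), add_comm (Finsupp.single d 1)]
  exact confluent_of_disjoint hcd hef v

variable (K a b) in
/-- The first syzygy module is generated by the linear syzygies. -/
theorem linearSpan_eq_firstSyzygy :
    linearSpan K (Fin a × Fin b) = firstSyzygy K (Fin a × Fin b) := by
  refine le_antisymm (linearSpan_le_firstSyzygy K) fun z hz => ?_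
  obtain ⟨φ, hφ⟩ := LabeledPath.exists_potential (step := HibiStepMod K (a := a) (b := b))
    gridWeight (by rintro _ _ _ ⟨z, h, -⟩; exact h.gridWeight_lt) hibiStepMod_confluent
  let Φ : MvPolynomial (Fin a × Fin b) K →ₗ[K] LinearQuotient K a b :=
    (basisMonomials (Fin a × Fin b) K).constr K φ
  have hΦ : ∀ M, Φ (monomial M 1) = φ M := by
    intro M
    have := (basisMonomials (Fin a × Fin b) K).constr_basis K φ M
    rwa [coe_basisMonomials] at this
  -- On `x^M g_{(c, d)}` this is the potential equation for the straightening step that starts at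
  -- `x^M x_c x_d`.
  have key : Φ ∘ₗ (diamondMap K (Fin a × Fin b)).restrictScalars K =
      (linearSpan K (Fin a × Fin b)).mkQ.restrictScalars K := by
    refine Finsupp.lhom_ext' fun s => (basisMonomials (Fin a × Fin b) K).ext fun M => ?_
    obtain ⟨c, d, h, rfl⟩ := exists_eq_diamondOf s
    have h₁ := hφ _ _ _ ⟨_, HibiStep.of_diamond (K := K) h M, rfl⟩
    rw [← sub_eq_iff_eq_add, ← hΦ, ← hΦ, ← map_sub,
      ← (HibiStep.of_diamond (K := K) h M).diamondMap_eq, pairGen_of_incomparable K h,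
      Finsupp.smul_single, smul_eq_mul, mul_one] at h₁
    rw [coe_basisMonomials]
    exact h₁
  have h := LinearMap.congr_fun key z
  simp only [LinearMap.comp_apply, LinearMap.restrictScalars_apply] at h
  rw [show diamondMap K _ z = 0 from hz, map_zero, Submodule.mkQ_apply, eq_comm,
    Submodule.Quotient.mk_eq_zero] at h
  exact h

end Grid

/-! ### Dimension of the space of linear syzygies. -/

section Counting

theorem card_exponents (σ : Type*) [Finite σ] (k : ℕ) :
    Nat.card {M : σ →₀ ℕ // M.degree = k} = (Nat.card σ).multichoose k := by
  classical
  have := Fintype.ofFinite σ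
  rw [Nat.card_eq_fintype_card (α := σ), ← Sym.card_sym_eq_multichoose σ k,
    ← Nat.card_eq_fintype_card]
  exact (Nat.card_congr (Sym.equivNatSum σ k)).symm

instance (σ : Type*) [Finite σ] (k : ℕ) : Finite {M : σ →₀ ℕ // M.degree = k} := by
  classical
  have := Fintype.ofFinite σ
  exact Finite.of_equiv _ (Sym.equivNatSum σ k)

theorem card_increasing_pairs (a : ℕ) :
    Nat.card {x : Fin a × Fin a // x.1 < x.2} = a.choose 2 := by
  have h := Sym2.card_subtype_not_diag (α := Fin a)
  rw [Fintype.card_fin, ← Nat.card_eq_fintype_card] at h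
  rw [← h]
  refine Nat.card_eq_of_bijective (fun x => ⟨s(x.1.1, x.1.2), by simpa using x.2.ne⟩) ⟨?_, ?_⟩
  · rintro ⟨⟨i, j⟩, h⟩ ⟨⟨i', j'⟩, h'⟩ e
    have e := congrArg Subtype.val e
    simp only [Sym2.eq_iff] at e
    rcases e with ⟨rfl, rfl⟩ | ⟨rfl, rfl⟩
    · rfl
    · exact absurd h (lt_asymm h')
  · rintro ⟨e, he⟩
    induction e using Sym2.ind with
    | _ i j =>
      rw [Sym2.mk_isDiag_iff] at he
      rcases lt_or_gt_of_ne he with h | h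
      · exact ⟨⟨(i, j), h⟩, rfl⟩
      · exact ⟨⟨(j, i), h⟩, Subtype.ext Sym2.eq_swap⟩

/-- A diamond is the antidiagonal of a unique choice of two rows and two columns. -/
theorem card_diamond (a b : ℕ) :
    Nat.card (Diamond (Fin a × Fin b)) = a.choose 2 * b.choose 2 := by
  rw [← card_increasing_pairs, ← card_increasing_pairs, ← Nat.card_prod]
  symm
  have hinc : ∀ (x : {x : Fin a × Fin a // x.1 < x.2}) (y : {y : Fin b × Fin b // y.1 < y.2}),
      ¬ (x.1.1, y.1.2) ≤ (x.1.2, y.1.1) ∧ ¬ (x.1.2, y.1.1) ≤ (x.1.1, y.1.2) := fun x y =>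
    ⟨fun h => absurd (Prod.mk_le_mk.1 h).2 y.2.not_ge, fun h => absurd (Prod.mk_le_mk.1 h).1 x.2.not_ge⟩
  refine Nat.card_eq_of_bijective (fun q => diamondOf (hinc q.1 q.2)) ⟨?_, ?_⟩
  · rintro ⟨⟨⟨i, i'⟩, h⟩, ⟨⟨j, j'⟩, k⟩⟩ ⟨⟨⟨p, p'⟩, h'⟩, ⟨⟨q, q'⟩, k'⟩⟩ e
    have e := congrArg Subtype.val e
    simp only [diamondOf, Sym2.eq_iff, Prod.mk.injEq] at e
    rcases e with ⟨⟨rfl, rfl⟩, rfl, rfl⟩ | ⟨⟨rfl, rfl⟩, rfl, rfl⟩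
    · rfl
    · exact absurd h (lt_asymm h')
  · intro s
    obtain ⟨⟨i, j⟩, ⟨i', j'⟩, h, rfl⟩ := exists_eq_diamondOf s
    rw [Prod.mk_le_mk, Prod.mk_le_mk] at h
    rcases lt_or_ge i i' with hi | hi
    · have hj : j' < j := lt_of_not_ge fun hj => h.1 ⟨hi.le, hj⟩
      exact ⟨⟨⟨(i, i'), hi⟩, ⟨(j', j), hj⟩⟩, rfl⟩
    · have hj : j < j' := lt_of_not_ge fun hj => h.2 ⟨hi, hj⟩
      have hi' : i' < i := lt_of_not_ge fun hi' => h.1 ⟨hi', hj.le⟩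
      exact ⟨⟨⟨(i', i), hi'⟩, ⟨(j, j'), hj⟩⟩, diamondOf_comm _⟩

/-- The row and column sums of a matrix of exponents of degree three. -/
def cubicMarginals {α β : Type*} (M : {M : α × β →₀ ℕ // M.degree = 3}) :
    {u : α →₀ ℕ // u.degree = 3} × {v : β →₀ ℕ // v.degree = 3} :=
  (⟨M.1.mapDomain Prod.fst, (degree_mapDomain_nat _ _).trans M.2⟩,
    ⟨M.1.mapDomain Prod.snd, (degree_mapDomain_nat _ _).trans M.2⟩)

theorem cubicMarginals_eq_iff {α β : Type*} {M N : {M : α × β →₀ ℕ // M.degree = 3}} :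
    cubicMarginals M = cubicMarginals N ↔ marginals M.1 = marginals N.1 := by
  simp [cubicMarginals, marginals]

theorem exists_eq_sum_of_degree_eq_three {σ : Type*} {u : σ →₀ ℕ} (h : u.degree = 3) :
    ∃ x y z, u = Finsupp.single x 1 + Finsupp.single y 1 + Finsupp.single z 1 := by
  obtain ⟨u₂, z, rfl, h₂⟩ := exists_add_single_of_degree_eq_succ h
  obtain ⟨u₁, y, rfl, h₁⟩ := exists_add_single_of_degree_eq_succ h₂
  obtain ⟨u₀, x, rfl, h₀⟩ := exists_add_single_of_degree_eq_succ h₁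
  rw [(Finsupp.degree_eq_zero_iff _).1 h₀, zero_add]
  exact ⟨x, y, z, rfl⟩

theorem cubicMarginals_surjective {α β : Type*} :
    Function.Surjective (cubicMarginals (α := α) (β := β)) := by
  rintro ⟨⟨u, hu⟩, ⟨v, hv⟩⟩
  obtain ⟨x, y, z, rfl⟩ := exists_eq_sum_of_degree_eq_three hu
  obtain ⟨x', y', z', rfl⟩ := exists_eq_sum_of_degree_eq_three hv
  refine ⟨⟨Finsupp.single (x, x') 1 + Finsupp.single (y, y') 1 + Finsupp.single (z, z') 1,
    by simp⟩, ?_⟩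
  simp [cubicMarginals, Finsupp.mapDomain_add, Finsupp.mapDomain_single]

variable (K : Type*) [Field K]

/-- The cubic form with given coefficients. -/
def cubicForm (σ : Type*) : ({M : σ →₀ ℕ // M.degree = 3} →₀ K) →ₗ[K] MvPolynomial σ K :=
  Finsupp.linearCombination K fun M => monomial M.1 1

theorem cubicForm_single (σ : Type*) (M : {M : σ →₀ ℕ // M.degree = 3}) :
    cubicForm K σ (Finsupp.single M 1) = monomial M.1 1 := by
  simp [cubicForm]

theorem cubicForm_injective (σ : Type*) : Function.Injective (cubicForm K σ) := by
  have h := (basisMonomials σ K).linearIndependent.comp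
    (Subtype.val : {M : σ →₀ ℕ // M.degree = 3} → σ →₀ ℕ) Subtype.val_injective
  rw [coe_basisMonomials] at h
  exact h

variable {K} in
theorem monomial_sub_monomial_mem_range {a b : ℕ} {M N : Fin a × Fin b →₀ ℕ} (hM : M.degree = 3)
    (hN : N.degree = 3) (h : marginals M = marginals N) :
    (monomial M 1 - monomial N 1 : MvPolynomial (Fin a × Fin b) K) ∈
      LinearMap.range ((diamondMap K (Fin a × Fin b)).restrictScalars K ∘ₗ
        linearEmb K (Fin a × Fin b)) := by
  have hμ : ∀ (M : Fin a × Fin b →₀ ℕ) (q) (N), HibiStep K M q N → gridWeight N < gridWeight M :=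
    fun _ _ _ h => h.gridWeight_lt
  obtain ⟨z₁, P₁, hp₁, hP₁⟩ := LabeledPath.exists_normal gridWeight hμ M
  obtain ⟨z₂, P₂, hp₂, hP₂⟩ := LabeledPath.exists_normal gridWeight hμ N
  obtain rfl : P₁ = P₂ := eq_of_chain_of_marginals_eq
    (fun _ hx _ hy => comparable_of_normal hP₁ hx hy)
    (fun _ hx _ hy => comparable_of_normal hP₂ hx hy)
    (hp₁.marginals_eq.trans (h.trans hp₂.marginals_eq.symm))
  obtain ⟨c, hc⟩ := sub_mem (hp₁.mem_range hM) (hp₂.mem_range hN)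
  refine ⟨c, ?_⟩
  rw [LinearMap.comp_apply, hc, LinearMap.restrictScalars_apply, map_sub, hp₁.diamondMap_eq,
    hp₂.diamondMap_eq, sub_sub_sub_cancel_right]

/-- The cubic part of the Hibi ideal consists of the cubic forms whose coefficients sum to zero
over all monomials with the same row and column sums. -/
theorem range_linear_eq (a b : ℕ) :
    LinearMap.range ((diamondMap K (Fin a × Fin b)).restrictScalars K ∘ₗ
        linearEmb K (Fin a × Fin b)) =
      (LinearMap.ker (Finsupp.lmapDomain K K (cubicMarginals (α := Fin a) (β := Fin b)))).map
        (cubicForm K (Fin a × Fin b)) := by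
  apply le_antisymm
  · rintro _ ⟨c, rfl⟩
    induction c using Finsupp.induction_linear with
    | zero => rw [map_zero]; exact zero_mem _
    | add c d hc hd => rw [map_add]; exact add_mem hc hd
    | single q r =>
      obtain ⟨s, p⟩ := q
      obtain ⟨c, d, h, rfl⟩ := exists_eq_diamondOf s
      have hs := HibiStep.of_diamond (K := K) h (Finsupp.single p 1)
      have h₁ := hs.diamondMap_eq
      let M : {M : Fin a × Fin b →₀ ℕ // M.degree = 3} := ⟨_, show Finsupp.degree
        (Finsupp.single p 1 + (Finsupp.single c 1 + Finsupp.single d 1)) = 3 by simp⟩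
      let N : {M : Fin a × Fin b →₀ ℕ // M.degree = 3} := ⟨_, hs.degree_eq.trans M.2⟩
      refine ⟨r • (Finsupp.single M 1 - Finsupp.single N 1), ?_, ?_⟩
      · have hMN : cubicMarginals N = cubicMarginals M := cubicMarginals_eq_iff.2 hs.marginals_eq
        simp [Finsupp.mapDomain_sub, hMN]
      · rw [map_smul, map_sub, cubicForm_single, cubicForm_single, ← h₁, LinearMap.comp_apply,
          linearEmb_single, map_smul (_ : _ →ₗ[K] _), pairGen_of_incomparable K h, Finsupp.smul_single,
          smul_eq_mul, mul_one]
        rfl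
  · rintro _ ⟨x, hx, rfl⟩
    -- `σ` picks one monomial for each pair of marginals; modulo the range, every monomial may be
    -- replaced by its representative.
    obtain ⟨σ, hσ⟩ := (cubicMarginals_surjective (α := Fin a) (β := Fin b)).hasRightInverse
    have key : ∀ x : {M : Fin a × Fin b →₀ ℕ // M.degree = 3} →₀ K,
        cubicForm K _ x - cubicForm K _ (Finsupp.lmapDomain K K σ
          (Finsupp.lmapDomain K K (cubicMarginals (α := Fin a) (β := Fin b)) x)) ∈
        LinearMap.range ((diamondMap K (Fin a × Fin b)).restrictScalars K ∘ₗ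
          linearEmb K (Fin a × Fin b)) := by
      intro x
      induction x using Finsupp.induction_linear with
      | zero => simp
      | add x y hx hy =>
        simp only [map_add, add_sub_add_comm]
        exact add_mem hx hy
      | single M r =>
        have h := monomial_sub_monomial_mem_range (K := K) M.2 (σ (cubicMarginals M)).2
          (cubicMarginals_eq_iff.1 (hσ _).symm)
        have h := Submodule.smul_mem _ r h
        rw [← cubicForm_single, ← cubicForm_single, smul_sub, ← map_smul, ← map_smul] at h
        simpa [Finsupp.mapDomain_single] using h
    have h := key x
    rwa [LinearMap.mem_ker.1 hx, map_zero, map_zero, sub_zero] at h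

/-- Rank-nullity is used twice: for the map from linear coefficients to cubic forms, whose range
`range_linear_eq` describes, and for the marginals map, which is onto. The additive form avoids
subtraction in `ℕ`. -/
theorem finrank_linearSyzygy_add (a b : ℕ) :
    Module.finrank K (linearSyzygy K (Fin a × Fin b)) + (a * b).multichoose 3 =
      a.choose 2 * b.choose 2 * (a * b) + a.multichoose 3 * b.multichoose 3 := by
  have h₁ := LinearMap.finrank_range_add_finrank_ker
    ((diamondMap K (Fin a × Fin b)).restrictScalars K ∘ₗ linearEmb K (Fin a × Fin b))
  have h₂ := LinearMap.finrank_range_add_finrank_ker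
    (Finsupp.lmapDomain K K (cubicMarginals (α := Fin a) (β := Fin b)))
  rw [range_linear_eq, ← ((LinearMap.ker (Finsupp.lmapDomain K K
    (cubicMarginals (α := Fin a) (β := Fin b)))).equivMapOfInjective (cubicForm K (Fin a × Fin b))
      (cubicForm_injective K _)).finrank_eq] at h₁
  rw [LinearMap.range_eq_top.2 (Finsupp.mapDomain_surjective cubicMarginals_surjective),
    finrank_top] at h₂
  simp only [Module.finrank_eq_nat_card_basis (Finsupp.basisSingleOne (R := K)), Nat.card_prod,
    card_exponents, card_diamond, Nat.card_fin] at h₁ h₂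
  rw [linearSyzygy]
  omega

theorem cast_choose_three (n : ℕ) : (n.choose 3 : ℚ) = n * (n - 1) * (n - 2) / 6 := by
  induction n with
  | zero => simp
  | succ n ih =>
    rw [Nat.choose_succ_succ' n 2, Nat.cast_add, ih, Nat.cast_choose_two]
    push_cast
    ring

theorem finrank_linearSyzygy_grid (m n : ℕ) :
    (Module.finrank K (linearSyzygy K (Grid m n)) : ℚ) = stripS m n + typeL m n + boxB m n := by
  have h := congrArg (Nat.cast (R := ℚ)) (finrank_linearSyzygy_add K (m + 1) (n + 1))
  have e : ∀ k : ℕ, (k.multichoose 3 : ℚ) = (k + 2) * (k + 1) * k / 6 := by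
    intro k
    rw [Nat.multichoose_eq, show k + 3 - 1 = k + 2 from rfl, cast_choose_three]
    push_cast
    ring
  simp only [Nat.cast_add, Nat.cast_mul, Nat.cast_choose_two, e, Nat.cast_one] at h
  simp only [stripS, stripT, typeL, boxB, boxB2, typeL2, cast_choose_three, Nat.cast_choose_two,
    Nat.cast_add, Nat.cast_one]
  linear_combination h

end Counting

/-! ### Transfer to minimal graded free resolutions. -/

section Resolution

theorem constantCoeff_eq_zero_of_mem_span_X {K σ : Type*} [Field K] {p : MvPolynomial σ K}
    (hp : p ∈ Ideal.span (Set.range (X : σ → MvPolynomial σ K))) :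
    p ∈ RingHom.ker (constantCoeff : MvPolynomial σ K →+* K) := by
  have h : Ideal.span (Set.range (X : σ → MvPolynomial σ K)) ≤
      RingHom.ker (constantCoeff : MvPolynomial σ K →+* K) := by
    rw [Ideal.span_le]
    rintro _ ⟨i, rfl⟩
    exact constantCoeff_X K i
  exact h hp

namespace MinimalGradedFreeResolution

variable {K σ : Type*} [Field K] {I : Ideal (MvPolynomial σ K)}

theorem d_mem (F : MinimalGradedFreeResolution K σ I) (i : ℕ)
    (x : Fin (F.rank (i + 1)) → MvPolynomial σ K) :
    F.d i x ∈ RingHom.ker (constantCoeff : MvPolynomial σ K →+* K) •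
      (⊤ : Submodule (MvPolynomial σ K) (Fin (F.rank i) → MvPolynomial σ K)) := by
  rw [pi_eq_sum_univ' x, map_sum]
  refine sum_mem fun j _ => ?_
  rw [map_smul]
  refine Submodule.smul_mem _ _ (mem_smul_top_of_forall_apply_mem fun k => ?_)
  convert constantCoeff_eq_zero_of_mem_span_X (F.minimal i j k)
/-- The second rank of a minimal graded free resolution of `P / I` can be computed from any
presentation of the first syzygies of `I` that is minimal at the origin. -/
theorem rank_two_eq (F : MinimalGradedFreeResolution K σ I) {G₁ : Type*} [AddCommGroup G₁]
    [Module (MvPolynomial σ K) G₁] [Module.Projective (MvPolynomial σ K) G₁] {N : ℕ}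
    (e₀ : G₁ →ₗ[MvPolynomial σ K] MvPolynomial σ K)
    (e₁ : (Fin N → MvPolynomial σ K) →ₗ[MvPolynomial σ K] G₁)
    (h₀ : LinearMap.range e₀ = I) (h₁ : Function.Exact e₁ e₀)
    (hmin₁ : ∀ x, e₁ x ∈ RingHom.ker (constantCoeff : MvPolynomial σ K →+* K) •
      (⊤ : Submodule (MvPolynomial σ K) G₁))
    (hmin₂ : ∀ x, e₁ x = 0 → x ∈ RingHom.ker (constantCoeff : MvPolynomial σ K →+* K) •
      (⊤ : Submodule (MvPolynomial σ K) (Fin N → MvPolynomial σ K))) :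
    F.rank 2 = N := by
  have hη : Function.Exact e₀ (Submodule.mkQ I) := by
    rw [LinearMap.exact_iff, Submodule.ker_mkQ, h₀]
  have hηs : Function.Surjective (Submodule.mkQ I) := Submodule.mkQ_surjective I
  obtain ⟨a₀, a₁, a₂, ha₀, ha₁, ha₂⟩ := exists_chain_map F.exact_zero.linearMap_comp_eq_zero
    (F.exact_succ 0).linearMap_comp_eq_zero hηs hη h₁
  obtain ⟨b₀, b₁, b₂, hb₀, hb₁, hb₂⟩ := exists_chain_map hη.linearMap_comp_eq_zero
    h₁.linearMap_comp_eq_zero F.aug_surjective F.exact_zero (F.exact_succ 0)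
  -- By exactness the kernel of `F.d 1` is the image of `F.d 2`, whose entries have no constant
  -- term.
  have hF : ∀ x, F.d 1 x = 0 → x ∈ RingHom.ker (constantCoeff : MvPolynomial σ K →+* K) •
      (⊤ : Submodule (MvPolynomial σ K) (Fin (F.rank 2) → MvPolynomial σ K)) := by
    intro x hx
    obtain ⟨y, rfl⟩ := (F.exact_succ 1 x).1 hx
    exact F.d_mem 2 y
  apply le_antisymm
  · refine le_of_comp_sub_self_mem constantCoeff a₂ b₂ fun x => ?_
    refine chain_map_sub_self_mem _ (s₀ := b₀ ∘ₗ a₀) (s₁ := b₁ ∘ₗ a₁) (s₂ := b₂ ∘ₗ a₂)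
      F.exact_zero (F.exact_succ 0) (F.d_mem 1) hF ?_ ?_ ?_ x
    · rw [← LinearMap.comp_assoc, hb₀, ha₀]
    · rw [← LinearMap.comp_assoc, hb₁, LinearMap.comp_assoc, ha₁, LinearMap.comp_assoc]
    · rw [← LinearMap.comp_assoc, hb₂, LinearMap.comp_assoc, ha₂, LinearMap.comp_assoc]
  · refine le_of_comp_sub_self_mem constantCoeff b₂ a₂ fun x => ?_
    refine chain_map_sub_self_mem _ (s₀ := a₀ ∘ₗ b₀) (s₁ := a₁ ∘ₗ b₁) (s₂ := a₂ ∘ₗ b₂)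
      hη h₁ hmin₁ hmin₂ ?_ ?_ ?_ x
    · rw [← LinearMap.comp_assoc, ha₀, hb₀]
    · rw [← LinearMap.comp_assoc, ha₁, LinearMap.comp_assoc, hb₁, LinearMap.comp_assoc]
    · rw [← LinearMap.comp_assoc, ha₂, LinearMap.comp_assoc, hb₂, LinearMap.comp_assoc]

end MinimalGradedFreeResolution

/-- A basis of the linear syzygies gives the presentation to compare with: its entries have no
constant term, and a relation among the basis vectors has zero constant terms because their linear
parts are independent. -/
theorem rank_two_eq_finrank_linearSyzygy {K L : Type*} [Field K] [Lattice L] [Finite L]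
    (h : linearSpan K L = firstSyzygy K L)
    (F : MinimalGradedFreeResolution K L (hibiIdeal K L)) :
    F.rank 2 = Module.finrank K (linearSyzygy K L) := by
  obtain ⟨v, hv, hs⟩ := exists_linear_generators K L
  let e₁ := Fintype.linearCombination (MvPolynomial L K) fun i => linearEmb K L (v i)
  have hr : LinearMap.range e₁ = firstSyzygy K L := by
    rw [Fintype.range_linearCombination, hs, h]
  have hmem : ∀ i, linearEmb K L (v i) ∈ firstSyzygy K L := by
    intro i
    rw [← h, ← hs]
    exact Submodule.subset_span ⟨i, rfl⟩
  refine F.rank_two_eq (diamondMap K L) e₁ ?_ ?_ ?_ ?_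
  · rw [diamondMap, Finsupp.range_linearCombination]
    rfl
  · rw [LinearMap.exact_iff, hr]
    rfl
  · intro x
    have hx : e₁ x ∈ firstSyzygy K L := hr ▸ LinearMap.mem_range_self e₁ x
    rw [← Finsupp.sum_single (e₁ x)]
    refine sum_mem fun s _ => ?_
    rw [← mul_one (e₁ x s), ← smul_eq_mul, ← Finsupp.smul_single]
    exact Submodule.smul_mem_smul (constantCoeff_eq_zero_of_mem_firstSyzygy K hx s) trivial
  · intro x hx
    refine mem_smul_top_of_forall_apply_mem fun i => ?_
    have h₁ := congrArg (linearCoeff K L) hx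
    simp only [e₁, Fintype.linearCombination_apply, map_sum, map_zero,
      linearCoeff_smul K (hmem _), linearCoeff_linearEmb] at h₁
    refine Fintype.linearIndependent_iff.1 hv (fun i => constantCoeff (x i)) ?_ i
    ext q
    simpa using congrFun h₁ q

end Resolution

end

theorem mainTheorem8 (K : Type*) [Field K] (m n : ℕ) :
    (firstBetti K (Grid m n) : ℚ) = stripS m n + typeL m n + boxB m n ∧
    ∀ F : MinimalGradedFreeResolution K (Grid m n) (hibiIdeal K (Grid m n)),
      (F.rank 2 : ℚ) = stripS m n + typeL m n + boxB m n := by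
  have h := linearSpan_eq_firstSyzygy K (m + 1) (n + 1)
  refine ⟨?_, fun F => ?_⟩
  · rw [firstBetti_eq K h, finrank_linearSyzygy_grid]
  · rw [rank_two_eq_finrank_linearSyzygy h F, finrank_linearSyzygy_grid]
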